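/- Let $\mathfrak{B}$ be the set of odd positive integers that are sums of two coprime squares, and, for real $\alpha$ and $N$, let $S(\alpha;N)=\sum_{b\in\mathfrak{B},\, b\le N}e(b\alpha)$, where $e(x)=\exp(2\pi i x)$. Then, for all real $N\ge 2$, $$S(\sqrt{2};N)\ll N^{5/6}(\log N)^{13/2},$$ where the implied constant is absolute. -/

import Mathlib

noncomputable section

/-- The odd primitive Gaussian integers: odd (positive) integers that are sums of two coprime
squares. The value `1 = 1 ^ 2 + 0 ^ 2` is included. -/
def oddPrimitiveGaussian : Set ℕ :=
  {n | Odd n ∧ ∃ u v : ℕ, Nat.Coprime u v ∧ n = u ^ 2 + v ^ 2}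

/-- The characteristic function `b` of the set of odd primitive Gaussian integers. -/
def gaussB (n : ℕ) : ℂ := oddPrimitiveGaussian.indicator 1 n

/-- The additive character `e(x) = exp(2πix)`. -/
def expE (x : ℝ) : ℂ := Complex.exp (2 * Real.pi * Complex.I * x)

/-- The trigonometric polynomial `S(α; N) = ∑_{n ≤ N} b(n) e(nα)`, the sum being over the positive
integers `n` up to the real number `N`. -/
def trigS (α N : ℝ) : ℂ :=
  ∑ n ∈ Finset.Icc 1 ⌊N⌋₊, gaussB n * expE (n * α)

end

/-!
Write `n = ⌊N⌋`. An integer `m ≥ 1` is an odd primitive Gaussian integer exactly when all its prime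
factors are `1 mod 4`. If `m ≡ 1 mod 4` has a prime factor `3 mod 4`, it has at least two of them
(with multiplicity), so one of them is at most `√m`. Hence, for `m ≤ n`, the condition amounts to
`m ≡ 1 mod 4` together with the absence of prime factors `p ≡ 3 mod 4` with `p ^ 2 ≤ n`: a sieve
up to `√n` detects the sequence exactly (`mem_oddPrimitiveGaussian_iff_sieve`).

The sieve is expanded by iterating Buchstab's identity over decreasing primes until the divisor
exceeds `n ^ (1 / 3)`. The divisors `d ≤ n ^ (1 / 3)` keep their Legendre weight `μ(d)`. Those that
have just crossed the threshold, `d > n ^ (1 / 3) ≥ d / P⁻(d)` with `P⁻(d)` the least prime factor,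
carry `μ(d)` times the indicator that `m / d` has no prime factor `3 mod 4` below `P⁻(d)`; they
satisfy `d ≤ n ^ (2 / 3)` (`gaussB_eq_sum_sieveWeight`, `IsCrossing.pow_three_le_sq`).

The first family is a linear sum: the inner sum over `m / d` is geometric and is `O(d)`, because
the distance from `j√2` to the nearest integer is at least `1 / (4 j)`. The total is
`O(n ^ (2 / 3))` (`norm_sum_smallWeight_le`).

The second family is a bilinear form in `k = d` and `l = m / d`, with the coupling
`P⁻(k) ≤ P₃⁻(l)`, where `P₃⁻(l)` is the least prime factor `3 mod 4` of `l`. For `k` in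
`[K, 2 K)`, the form without the coupling has operator norm squared at most
`n / K + 32 K (1 + log (16 K))` by Cauchy's inequality, the multiples of `4√2` being well spaced
modulo one (`sum_inv_distInt_le`, `norm_dyadic_bilinear_le`). Restoring the coupling is a
triangular truncation, which costs one logarithm (`norm_triangular_bilinear_le`). As
`n ^ (1 / 3) ≪ K ≤ n ^ (2 / 3)`, each dyadic block is `O(n ^ (5 / 6) log ^ 2 n)`, and summing over
the blocks gives `O(N ^ (5 / 6) log ^ 3 N)`, which is stronger than required.
-/

section

open Finset

/-! ### Odd primitive Gaussian integers and their prime factors -/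

theorem mod_four_eq_one_of_forall_prime {n : ℕ} (hn : n ≠ 0)
    (h : ∀ p : ℕ, p.Prime → p ∣ n → p % 4 = 1) : n % 4 = 1 := by
  induction n using Nat.recOnMul with
  | zero => exact absurd rfl hn
  | one => rfl
  | prime p hp => exact h p hp dvd_rfl
  | mul a b iha ihb =>
    have ha := iha (left_ne_zero_of_mul hn) fun p hp hd => h p hp (hd.mul_right b)
    have hb := ihb (right_ne_zero_of_mul hn) fun p hp hd => h p hp (hd.mul_left a)
    rw [Nat.mul_mod, ha, hb]

/-- If the product of the primitive Gaussian integer `u + v i` by `a + b i`, of prime norm `p`, is not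
divisible by `p`, then it is primitive: a common prime factor of its coordinates divides `u p` and
`v p`, hence divides `p`. -/
theorem isCoprime_gaussian_mul {u v a b p : ℤ} (huv : IsCoprime u v) (hp : Prime p)
    (hab : p = a ^ 2 + b ^ 2) (h : ¬(p ∣ u * a - v * b ∧ p ∣ u * b + v * a)) :
    IsCoprime (u * a - v * b) (u * b + v * a) := by
  refine isCoprime_of_prime_dvd (fun h0 => h ⟨by simp [h0.1], by simp [h0.2]⟩) ?_
  intro q hq h1 h2
  have hu : q ∣ u * p := by
    have : u * p = (u * a - v * b) * a + (u * b + v * a) * b := by rw [hab]; ring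
    rw [this]; exact dvd_add (h1.mul_right _) (h2.mul_right _)
  have hv : q ∣ v * p := by
    have : v * p = (u * b + v * a) * a - (u * a - v * b) * b := by rw [hab]; ring
    rw [this]; exact dvd_sub (h2.mul_right _) (h1.mul_right _)
  have hqp : q ∣ p := by
    by_contra hqp
    exact hq.not_isUnit (huv.isUnit_of_dvd' ((hq.dvd_or_dvd hu).resolve_right hqp)
      ((hq.dvd_or_dvd hv).resolve_right hqp))
  have hpq : p ∣ q := (hq.associated_of_dvd hp hqp).symm.dvd
  exact h ⟨hpq.trans h1, hpq.trans h2⟩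

/-- Multiply a primitive representation of `n` by `a + b i` or by `a - b i`, where
`p = a ^ 2 + b ^ 2`: at least one of the two products is primitive. -/
theorem exists_coprime_sq_add_sq_mul {n p : ℕ} (hp : p.Prime) (hp1 : p % 4 = 1)
    (hn : ∃ u v : ℤ, IsCoprime u v ∧ (n : ℤ) = u ^ 2 + v ^ 2) :
    ∃ u v : ℤ, IsCoprime u v ∧ ((p * n : ℕ) : ℤ) = u ^ 2 + v ^ 2 := by
  obtain ⟨u, v, huv, hn⟩ := hn
  have := Fact.mk hp
  obtain ⟨a, b, hab⟩ := Nat.Prime.sq_add_sq (p := p) (by omega)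
  have hab' : (p : ℤ) = (a : ℤ) ^ 2 + (b : ℤ) ^ 2 := by exact_mod_cast hab.symm
  have hpZ : Prime (p : ℤ) := Nat.prime_iff_prime_int.mp hp
  have hp2 : ¬ (p : ℤ) ∣ 2 := by
    intro h
    have h' : p ∣ 2 := by exact_mod_cast h
    have := Nat.le_of_dvd (by norm_num) h'
    have := hp.two_le
    have : p = 2 := by omega
    omega
  have key : ∀ c d : ℕ, c ^ 2 + d ^ 2 = p → ¬ (p : ℤ) ∣ (c : ℤ) := by
    intro c d hcd h
    have h1 : p ∣ c := by exact_mod_cast h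
    have h2 : p ∣ d := by
      have : p ∣ d ^ 2 := (Nat.dvd_add_right (dvd_pow h1 two_ne_zero)).mp (hcd ▸ dvd_rfl)
      exact hp.dvd_of_dvd_pow this
    have h3 : p ^ 2 ∣ p := by
      conv_rhs => rw [← hcd]
      exact dvd_add (pow_dvd_pow_of_dvd h1 2) (pow_dvd_pow_of_dvd h2 2)
    have := Nat.le_of_dvd hp.pos h3
    nlinarith [hp.two_le]
  by_cases h1 : (p : ℤ) ∣ u * a - v * b ∧ (p : ℤ) ∣ u * b + v * a
  · by_cases h2 : (p : ℤ) ∣ u * a - v * (-b) ∧ (p : ℤ) ∣ u * (-b) + v * a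
    · exfalso
      have hu : (p : ℤ) ∣ u := by
        have h3 : (p : ℤ) ∣ 2 * (a * u) := by
          have : 2 * (a * u) = (u * a - v * b) + (u * a - v * (-b)) := by ring
          rw [this]; exact dvd_add h1.1 h2.1
        exact ((hpZ.dvd_or_dvd ((hpZ.dvd_or_dvd h3).resolve_left hp2))).resolve_left (key a b hab)
      have hv : (p : ℤ) ∣ v := by
        have h3 : (p : ℤ) ∣ 2 * (a * v) := by
          have : 2 * (a * v) = (u * b + v * a) + (u * (-b) + v * a) := by ring
          rw [this]; exact dvd_add h1.2 h2.2
        exact ((hpZ.dvd_or_dvd ((hpZ.dvd_or_dvd h3).resolve_left hp2))).resolve_left (key a b hab)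
      exact hpZ.not_isUnit (huv.isUnit_of_dvd' hu hv)
    · refine ⟨_, _, isCoprime_gaussian_mul huv hpZ (by rw [hab']; ring) h2, ?_⟩
      push_cast; rw [hab', hn]; ring
  · refine ⟨_, _, isCoprime_gaussian_mul huv hpZ hab' h1, ?_⟩
    push_cast; rw [hab', hn]; ring

theorem exists_coprime_sq_add_sq {n : ℕ} (hn : n ≠ 0)
    (h : ∀ p : ℕ, p.Prime → p ∣ n → p % 4 = 1) :
    ∃ u v : ℤ, IsCoprime u v ∧ (n : ℤ) = u ^ 2 + v ^ 2 := by
  induction n using induction_on_primes with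
  | zero => exact absurd rfl hn
  | one => exact ⟨1, 0, isCoprime_one_left, by norm_num⟩
  | prime_mul p n hp ih =>
    exact exists_coprime_sq_add_sq_mul hp (h p hp (dvd_mul_right p n))
      (ih (right_ne_zero_of_mul hn) fun q hq hd => h q hq (hd.mul_left p))

theorem mem_oddPrimitiveGaussian_iff {n : ℕ} (hn : n ≠ 0) :
    n ∈ oddPrimitiveGaussian ↔ ∀ p : ℕ, p.Prime → p ∣ n → p % 4 = 1 := by
  constructor
  · rintro ⟨hodd, u, v, huv, h⟩ p hp hpn
    have h1 : IsSquare (-1 : ZMod n) := ZMod.isSquare_neg_one_of_eq_sq_add_sq_of_coprime h huv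
    have h3 : p % 4 ≠ 3 := Nat.mod_four_ne_three_of_mem_primeFactors_of_isSquare_neg_one
      (Nat.mem_primeFactors.mpr ⟨hp, hpn, hn⟩) h1
    have : p % 2 = 1 := Nat.odd_iff.mp (hodd.of_dvd_nat hpn)
    omega
  · intro h
    have h4 := mod_four_eq_one_of_forall_prime hn h
    refine ⟨Nat.odd_iff.mpr (by omega), ?_⟩
    obtain ⟨u, v, huv, he⟩ := exists_coprime_sq_add_sq hn h
    refine ⟨u.natAbs, v.natAbs, Int.isCoprime_iff_nat_coprime.mp huv, ?_⟩
    zify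
    simpa using he

theorem exists_prime_dvd_three_mod_four {m : ℕ} (hm : m % 4 = 3) :
    ∃ p : ℕ, p.Prime ∧ p % 4 = 3 ∧ p ∣ m := by
  by_contra! h
  have : m % 4 = 1 := by
    refine mod_four_eq_one_of_forall_prime (by rintro rfl; simp at hm) fun p hp hd => ?_
    have h3 : p % 4 ≠ 3 := fun h' => h p hp h' hd
    have : p % 2 = 1 := Nat.odd_iff.mp ((Nat.odd_iff.mpr (by omega : m % 2 = 1)).of_dvd_nat hd)
    omega
  omega

/-- Sieving by the primes `p ≡ 3 mod 4` with `p ^ 2 ≤ n` suffices within `m ≡ 1 mod 4`, since such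
an `m` has an even number of prime factors `3 mod 4`. -/
theorem mem_oddPrimitiveGaussian_iff_sieve {n m : ℕ} (hm : m ≠ 0) (hmn : m ≤ n) :
    m ∈ oddPrimitiveGaussian ↔
      m % 4 = 1 ∧ ∀ p : ℕ, p.Prime → p % 4 = 3 → p ^ 2 ≤ n → ¬ p ∣ m := by
  rw [mem_oddPrimitiveGaussian_iff hm]
  constructor
  · intro h
    refine ⟨mod_four_eq_one_of_forall_prime hm h, fun p hp h3 _ hd => ?_⟩
    have := h p hp hd
    omega
  · rintro ⟨h1, h⟩ p hp hd
    have hp2 : p % 2 = 1 := Nat.odd_iff.mp ((Nat.odd_iff.mpr (by omega : m % 2 = 1)).of_dvd_nat hd)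
    by_contra hp1
    have hp3 : p % 4 = 3 := by omega
    obtain ⟨k, rfl⟩ := hd
    have hk : k % 4 = 3 := by
      rw [Nat.mul_mod, hp3] at h1
      have := Nat.mod_lt k (by norm_num : 4 > 0)
      interval_cases k % 4 <;> omega
    obtain ⟨q, hq, hq3, hqk⟩ := exists_prime_dvd_three_mod_four hk
    have hqk' : q ≤ k := Nat.le_of_dvd (by omega) hqk
    have hpq : p * q ≤ n := (Nat.mul_le_mul_left p hqk').trans hmn
    rcases le_total p q with hle | hle
    · exact h p hp hp3 (by nlinarith) (dvd_mul_right p k)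
    · exact h q hq hq3 (by nlinarith) (hqk.mul_left p)

/-! ### Buchstab's identity stopped at the cube root -/

/-- The sieving moduli of level `n`: squarefree products of primes `p ≡ 3 mod 4` with
`p ^ 2 ≤ n`. -/
def IsSieveModulus (n d : ℕ) : Prop :=
  Squarefree d ∧ ∀ p : ℕ, p.Prime → p ∣ d → p % 4 = 3 ∧ p ^ 2 ≤ n

/-- No prime factor `p ≡ 3 mod 4` of `l` is smaller than the least prime factor of `k`. -/
def NoSmaller (k l : ℕ) : Prop :=
  ∀ p : ℕ, p.Prime → p % 4 = 3 → p ∣ l → k.minFac ≤ p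

/-- The divisor `d` exceeds `n ^ (1 / 3)`, but no longer does once its least prime factor is
removed. The two inequalities are cubed so as to stay among the natural numbers. -/
def IsCrossing (n d : ℕ) : Prop := n < d ^ 3 ∧ (d / d.minFac) ^ 3 ≤ n

open scoped Classical in
/-- The weight of the factorization `k * l` in the expansion of the sieve of level `n` by Buchstab's
identity, stopped when `k` crosses `n ^ (1 / 3)`. -/
noncomputable def sieveWeight (n k l : ℕ) : ℤ :=
  if IsSieveModulus n k then
    ArithmeticFunction.moebius k *
      ((if k ^ 3 ≤ n then 1 else 0) + (if IsCrossing n k ∧ NoSmaller k l then 1 else 0))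
  else 0

/-- Let `s` be the least sieving prime that divides `m`. At a divisor `d` prime to `s` the crossing
part of the weight vanishes, because `s` divides `m / d`. -/
theorem sieveWeight_of_not_dvd {n m s d : ℕ} (hn : 1 ≤ n) (hm : m ≠ 0) (hs : s.Prime)
    (hs3 : s % 4 = 3) (hsm : s ∣ m)
    (hmin : ∀ p : ℕ, p.Prime → p % 4 = 3 → p ^ 2 ≤ n → p ∣ m → s ≤ p)
    (hd : IsSieveModulus n d) (hdm : d ∣ m) (hsd : ¬ s ∣ d) :
    sieveWeight n d (m / d) = if d ^ 3 ≤ n then ArithmeticFunction.moebius d else 0 := by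
  have hno : ¬ (IsCrossing n d ∧ NoSmaller d (m / d)) := by
    rintro ⟨⟨h1, -⟩, h2⟩
    have hd1 : d ≠ 1 := by rintro rfl; omega
    have hp := Nat.minFac_prime hd1
    have hb := hd.2 _ hp d.minFac_dvd
    have h3 : s ≤ d.minFac := hmin _ hp hb.1 hb.2 (d.minFac_dvd.trans hdm)
    have h4 : s ∣ m / d := by
      obtain ⟨e, rfl⟩ := hdm
      rw [Nat.mul_div_cancel_left _ (Nat.pos_of_ne_zero (left_ne_zero_of_mul hm))]
      exact (hs.dvd_mul.mp hsm).resolve_left hsd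
    have h5 : d.minFac ≤ s := h2 s hs hs3 h4
    exact hsd (le_antisymm h3 h5 ▸ d.minFac_dvd)
  rw [sieveWeight, if_pos hd, if_neg hno]
  split_ifs <;> simp

/-- The weights at `d * s` and at `d` are opposite, for `s` the least sieving prime that divides `m`:
if `d ^ 3 ≤ n`, then `d * s` either stays below the threshold or has just crossed it. -/
theorem sieveWeight_mul_of_not_dvd {n m s d : ℕ} (hs : s.Prime)
    (hs3 : s % 4 = 3) (hsn : s ^ 2 ≤ n)
    (hmin : ∀ p : ℕ, p.Prime → p % 4 = 3 → p ^ 2 ≤ n → p ∣ m → s ≤ p)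
    (hd : IsSieveModulus n d) (hdm : d * s ∣ m) (hsd : ¬ s ∣ d) :
    IsSieveModulus n (d * s) ∧
    sieveWeight n (d * s) (m / (d * s)) =
      - if d ^ 3 ≤ n then ArithmeticFunction.moebius d else 0 := by
  have hcop : Nat.Coprime d s := ((Nat.Prime.coprime_iff_not_dvd hs).mpr hsd).symm
  have hgood : IsSieveModulus n (d * s) := by
    refine ⟨(Nat.squarefree_mul hcop).mpr ⟨hd.1, hs.prime.squarefree⟩, fun p hp hpd => ?_⟩
    rcases hp.dvd_mul.mp hpd with h | h
    · exact hd.2 p hp h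
    · rw [(Nat.prime_dvd_prime_iff_eq hp hs).mp h]; exact ⟨hs3, hsn⟩
  refine ⟨hgood, ?_⟩
  have hne : d * s ≠ 1 := fun h => hs.one_lt.ne' (Nat.eq_one_of_mul_eq_one_left h)
  have hfac : (d * s).minFac = s := by
    refine le_antisymm (Nat.minFac_le_of_dvd hs.two_le (dvd_mul_left s d)) ?_
    have hp := Nat.minFac_prime hne
    have hb := hgood.2 _ hp (Nat.minFac_dvd _)
    exact hmin _ hp hb.1 hb.2 ((Nat.minFac_dvd _).trans hdm)
  have hno : NoSmaller (d * s) (m / (d * s)) := by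
    intro p hp hp3 hpm
    rw [hfac]
    by_contra! hlt
    have := hmin p hp hp3 (by nlinarith) (hpm.trans (Nat.div_dvd_of_dvd hdm))
    omega
  have hmu : ArithmeticFunction.moebius (d * s) = - ArithmeticFunction.moebius d := by
    rw [ArithmeticFunction.isMultiplicative_moebius.map_mul_of_coprime hcop,
      ArithmeticFunction.moebius_apply_prime hs]; ring
  have hle : d ^ 3 ≤ (d * s) ^ 3 := Nat.pow_le_pow_left (Nat.le_mul_of_pos_right d hs.pos) 3
  rw [sieveWeight, if_pos hgood, hmu, IsCrossing, hfac, Nat.mul_div_cancel _ hs.pos]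
  by_cases h1 : (d * s) ^ 3 ≤ n
  · rw [if_pos h1, if_pos (hle.trans h1), if_neg (by omega)]; ring
  · rw [if_neg h1]
    by_cases h2 : d ^ 3 ≤ n
    · rw [if_pos h2, if_pos ⟨⟨by omega, h2⟩, hno⟩]; ring
    · rw [if_neg h2, if_neg (by tauto)]; ring

/-- The divisors `d` and `d * s` cancel, where `s` is the least sieving prime that divides `m`. -/
theorem sum_sieveWeight_eq_zero {n m : ℕ} (hn : 1 ≤ n) (hm : m ≠ 0)
    (h : ∃ p : ℕ, p.Prime ∧ p % 4 = 3 ∧ p ^ 2 ≤ n ∧ p ∣ m) :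
    ∑ d ∈ m.divisors, sieveWeight n d (m / d) = 0 := by
  classical
  obtain ⟨hs, hs3, hsn, hsm⟩ := Nat.find_spec h
  have hmin : ∀ p : ℕ, p.Prime → p % 4 = 3 → p ^ 2 ≤ n → p ∣ m → Nat.find h ≤ p :=
    fun p h1 h2 h3 h4 => Nat.find_min' h ⟨h1, h2, h3, h4⟩
  generalize Nat.find h = s at hs hs3 hsn hsm hmin
  have h0 : ∑ d ∈ m.divisors, sieveWeight n d (m / d)
      = ∑ d ∈ m.divisors with IsSieveModulus n d, sieveWeight n d (m / d) := by
    rw [sum_filter]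
    refine sum_congr rfl fun d _ => ?_
    split_ifs with hd
    · rfl
    · rw [sieveWeight, if_neg hd]
  rw [h0, ← sum_filter_add_sum_filter_not _ (fun d => s ∣ d)]
  have h1 : ∑ d ∈ (m.divisors.filter (IsSieveModulus n)) with s ∣ d, sieveWeight n d (m / d)
      = ∑ d ∈ (m.divisors.filter (IsSieveModulus n)) with ¬ s ∣ d,
          sieveWeight n (d * s) (m / (d * s)) := by
    refine sum_nbij' (· / s) (· * s) ?_ ?_ ?_ ?_ ?_
    · intro d hd
      simp only [mem_filter, Nat.mem_divisors] at hd ⊢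
      obtain ⟨⟨⟨hdm, -⟩, hg⟩, hsd⟩ := hd
      have hds : d / s ∣ d := Nat.div_dvd_of_dvd hsd
      refine ⟨⟨⟨hds.trans hdm, hm⟩, hg.1.squarefree_of_dvd hds,
        fun p hp hpd => hg.2 p hp (hpd.trans hds)⟩, fun hss => ?_⟩
      have : s * s ∣ d := by
        obtain ⟨e, rfl⟩ := hsd
        rw [Nat.mul_div_cancel_left _ hs.pos] at hss
        exact Nat.mul_dvd_mul_left s hss
      exact hs.one_lt.ne' (Nat.isUnit_iff.mp (hg.1 s this))
    · intro d hd
      simp only [mem_filter, Nat.mem_divisors] at hd ⊢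
      obtain ⟨⟨⟨hdm, -⟩, hg⟩, hsd⟩ := hd
      have hcop : Nat.Coprime d s := ((Nat.Prime.coprime_iff_not_dvd hs).mpr hsd).symm
      have hdsm : d * s ∣ m := hcop.mul_dvd_of_dvd_of_dvd hdm hsm
      exact ⟨⟨⟨hdsm, hm⟩, (sieveWeight_mul_of_not_dvd hs hs3 hsn hmin hg hdsm hsd).1⟩,
        dvd_mul_left s d⟩
    · intro d hd
      exact Nat.div_mul_cancel (mem_filter.mp hd).2
    · intro d hd
      exact Nat.mul_div_cancel _ hs.pos
    · intro d hd
      simp only [Nat.div_mul_cancel (mem_filter.mp hd).2]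
  rw [h1, ← sum_add_distrib]
  refine sum_eq_zero fun d hd => ?_
  simp only [mem_filter, Nat.mem_divisors] at hd
  obtain ⟨⟨⟨hdm, -⟩, hg⟩, hsd⟩ := hd
  have hcop : Nat.Coprime d s := ((Nat.Prime.coprime_iff_not_dvd hs).mpr hsd).symm
  rw [(sieveWeight_mul_of_not_dvd hs hs3 hsn hmin hg (hcop.mul_dvd_of_dvd_of_dvd hdm hsm) hsd).2,
    sieveWeight_of_not_dvd hn hm hs hs3 hsm hmin hg hdm hsd]
  ring

theorem sum_sieveWeight_eq_one {n m : ℕ} (hn : 1 ≤ n) (hm : m ≠ 0)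
    (h : ∀ p : ℕ, p.Prime → p % 4 = 3 → p ^ 2 ≤ n → ¬ p ∣ m) :
    ∑ d ∈ m.divisors, sieveWeight n d (m / d) = 1 := by
  rw [sum_eq_single_of_mem 1 (Nat.one_mem_divisors.mpr hm)]
  · have h1 : IsSieveModulus n 1 :=
      ⟨squarefree_one, fun p hp hp1 => absurd (Nat.dvd_one.mp hp1) hp.one_lt.ne'⟩
    have h2 : ¬ IsCrossing n 1 := by rintro ⟨h, -⟩; omega
    have h3 : ¬ (IsCrossing n 1 ∧ NoSmaller 1 (m / 1)) := fun h => h2 h.1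
    rw [sieveWeight, if_pos h1, if_neg h3, if_pos (by omega)]
    simp
  · intro d hd hd1
    rw [sieveWeight, if_neg]
    intro hg
    have hp := Nat.minFac_prime hd1
    have hb := hg.2 _ hp d.minFac_dvd
    exact h _ hp hb.1 hb.2 (d.minFac_dvd.trans (Nat.dvd_of_mem_divisors hd))

/-- The congruence is written in terms of `d * (m / d)` so that each term is a function of the two
factors `d` and `m / d`. -/
theorem gaussB_eq_sum_sieveWeight {n m : ℕ} (hm : m ≠ 0) (hmn : m ≤ n) :
    gaussB m = ∑ d ∈ m.divisors,
      if (d * (m / d)) % 4 = 1 then (sieveWeight n d (m / d) : ℂ) else 0 := by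
  classical
  have h1 : ∑ d ∈ m.divisors,
      (if (d * (m / d)) % 4 = 1 then (sieveWeight n d (m / d) : ℂ) else 0)
      = if m % 4 = 1 then ((∑ d ∈ m.divisors, sieveWeight n d (m / d) : ℤ) : ℂ) else 0 := by
    split_ifs with h
    · push_cast
      refine sum_congr rfl fun d hd => ?_
      rw [Nat.mul_div_cancel' (Nat.dvd_of_mem_divisors hd), if_pos h]
    · refine sum_eq_zero fun d hd => ?_
      rw [Nat.mul_div_cancel' (Nat.dvd_of_mem_divisors hd), if_neg h]
  rw [h1, gaussB, Set.indicator_apply, mem_oddPrimitiveGaussian_iff_sieve hm hmn]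
  by_cases h4 : m % 4 = 1
  · by_cases hp : ∀ p : ℕ, p.Prime → p % 4 = 3 → p ^ 2 ≤ n → ¬ p ∣ m
    · rw [if_pos ⟨h4, hp⟩, if_pos h4, sum_sieveWeight_eq_one (by omega) hm hp]; simp
    · rw [if_neg (fun h => hp h.2), if_pos h4, sum_sieveWeight_eq_zero (by omega) hm]
      · simp
      · push Not at hp; exact hp
  · rw [if_neg (fun h => h4 h.1), if_neg h4]

/-- If `d` is prime, then `d ^ 2 ≤ n`; otherwise `P⁻(d) ≤ d / P⁻(d) ≤ n ^ (1 / 3)`. -/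
theorem IsCrossing.pow_three_le_sq {n d : ℕ} (hd : IsSieveModulus n d) (h : IsCrossing n d)
    (hn : 1 ≤ n) : d ^ 3 ≤ n ^ 2 := by
  have hd1 : d ≠ 1 := by rintro rfl; have := h.1; omega
  have hp := Nat.minFac_prime hd1
  obtain ⟨e, he⟩ := d.minFac_dvd
  have hde : d / d.minFac = e := by
    conv_lhs => arg 1; rw [he]
    exact Nat.mul_div_cancel_left _ hp.pos
  have h2 := h.2
  rw [hde] at h2
  have he0 : e ≠ 0 := by rintro rfl; rw [mul_zero] at he; exact hd.1.ne_zero he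
  by_cases he1 : e = 1
  · have hb := (hd.2 _ hp d.minFac_dvd).2
    rw [he1, mul_one] at he
    rw [← he] at hb
    calc d ^ 3 ≤ d ^ 4 := Nat.pow_le_pow_right (Nat.pos_of_ne_zero hd.1.ne_zero) (by norm_num)
      _ = (d ^ 2) ^ 2 := by ring
      _ ≤ n ^ 2 := Nat.pow_le_pow_left hb 2
  · have hle : d.minFac ≤ e :=
      (Nat.minFac_le_of_dvd (Nat.minFac_prime he1).two_le
        (e.minFac_dvd.trans (he ▸ dvd_mul_left e _))).trans (Nat.minFac_le (Nat.pos_of_ne_zero he0))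
    calc d ^ 3 = d.minFac ^ 3 * e ^ 3 := by conv_lhs => rw [he, mul_pow]
      _ ≤ e ^ 3 * e ^ 3 := Nat.mul_le_mul_right _ (Nat.pow_le_pow_left hle 3)
      _ ≤ n * n := Nat.mul_le_mul h2 h2
      _ = n ^ 2 := by ring

theorem sum_sum_divisors {M : Type*} [AddCommMonoid M] (n : ℕ) (F : ℕ → ℕ → M) :
    ∑ m ∈ Icc 1 n, ∑ d ∈ m.divisors, F d (m / d)
      = ∑ k ∈ Icc 1 n, ∑ l ∈ Icc 1 n, if k * l ≤ n then F k l else 0 := by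
  simp_rw [← sum_filter]
  rw [sum_sigma', sum_sigma']
  refine sum_nbij' (fun x => ⟨x.2, x.1 / x.2⟩) (fun x => ⟨x.1 * x.2, x.1⟩) ?_ ?_ ?_ ?_ ?_
  · rintro ⟨m, d⟩ h
    simp only [mem_sigma, mem_Icc, Nat.mem_divisors, mem_filter] at h ⊢
    obtain ⟨⟨h1, h2⟩, ⟨e, rfl⟩, h3⟩ := h
    have hd := Nat.pos_of_ne_zero (left_ne_zero_of_mul h3)
    have he := Nat.pos_of_ne_zero (right_ne_zero_of_mul h3)
    rw [Nat.mul_div_cancel_left _ hd]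
    exact ⟨⟨hd, by nlinarith⟩, ⟨he, by nlinarith⟩, h2⟩
  · rintro ⟨k, l⟩ h
    simp only [mem_sigma, mem_Icc, Nat.mem_divisors, mem_filter] at h ⊢
    exact ⟨⟨by nlinarith, h.2.2⟩, dvd_mul_right k l, by nlinarith⟩
  · rintro ⟨m, d⟩ h
    simp only [mem_sigma, mem_Icc, Nat.mem_divisors] at h
    simp [Nat.mul_div_cancel' h.2.1]
  · rintro ⟨k, l⟩ h
    simp only [mem_sigma, mem_Icc] at h
    simp [Nat.mul_div_cancel_left l h.1.1]
  · rintro ⟨m, d⟩ h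
    rfl

/-! ### Distances to the nearest integer and multiples of the square root of two -/

/-- Distance to the nearest integer. -/
noncomputable def distInt (x : ℝ) : ℝ := |x - round x|

theorem distInt_nonneg (x : ℝ) : 0 ≤ distInt x := abs_nonneg _

theorem distInt_le (x : ℝ) (z : ℤ) : distInt x ≤ |x - z| := round_le x z

theorem distInt_neg (x : ℝ) : distInt (-x) = distInt x := by
  have key : ∀ y : ℝ, distInt (-y) ≤ distInt y := fun y => by
    have h := distInt_le (-y) (-round y)
    rwa [Int.cast_neg, ← neg_add', abs_neg, ← sub_eq_add_neg] at h
  exact le_antisymm (key x) (by simpa using key (-x))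

/-- The integer `2 j ^ 2 - m ^ 2 = (j√2 - m) (j√2 + m)` is nonzero. -/
theorem distInt_mul_sqrt_two {j : ℕ} (hj : 1 ≤ j) :
    1 / (4 * j : ℝ) ≤ distInt (j * Real.sqrt 2) := by
  have hj' : (1 : ℝ) ≤ j := by exact_mod_cast hj
  have hs : Real.sqrt 2 ^ 2 = 2 := Real.sq_sqrt (by norm_num)
  have hs1 : Real.sqrt 2 ≤ 3 / 2 := by
    rw [Real.sqrt_le_left (by norm_num)]; norm_num
  have hs0 : 0 ≤ Real.sqrt 2 := Real.sqrt_nonneg 2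
  unfold distInt
  set x := (j : ℝ) * Real.sqrt 2 with hx
  set m := round x
  have hx0 : 0 ≤ x := by positivity
  have hx1 : x ≤ 3 / 2 * j := by rw [hx]; nlinarith
  have hm : |x - m| ≤ 1 / 2 := abs_sub_round x
  have hm' := abs_le.mp hm
  have hne : (2 * (j : ℤ) ^ 2 - m ^ 2) ≠ 0 := by
    intro h
    have h2 : (m : ℝ) ^ 2 = 2 * (j : ℝ) ^ 2 := by
      have : (m : ℤ) ^ 2 = 2 * (j : ℤ) ^ 2 := by omega
      exact_mod_cast this
    have hirr := irrational_sqrt_two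
    apply hirr
    refine ⟨|m| / j, ?_⟩
    have h3 : (Real.sqrt 2 * j) ^ 2 = |(m : ℝ)| ^ 2 := by rw [mul_pow, hs, sq_abs, h2]
    have h4 : Real.sqrt 2 * j = |(m : ℝ)| :=
      (pow_left_inj₀ (by positivity) (abs_nonneg _) two_ne_zero).mp h3
    push_cast
    rw [← h4]
    field_simp
  have h1 : (1 : ℝ) ≤ |x - m| * |x + m| := by
    rw [← abs_mul]
    have : (x - m) * (x + m) = ((2 * (j : ℤ) ^ 2 - m ^ 2 : ℤ) : ℝ) := by
      push_cast; rw [← hs, hx]; ring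
    rw [this]
    exact_mod_cast Int.one_le_abs hne
  have h2 : |x + m| ≤ 4 * j := by
    rw [abs_le]; constructor <;> linarith
  rw [div_le_iff₀ (by positivity)]
  nlinarith [abs_nonneg (x - m)]

theorem distInt_mul_four_sqrt_two {j : ℕ} (hj : 1 ≤ j) :
    1 / (16 * j : ℝ) ≤ distInt (j * (4 * Real.sqrt 2)) := by
  have h := distInt_mul_sqrt_two (j := 4 * j) (by omega)
  push_cast at h
  convert h using 2 <;> ring

/-- The difference of the distances to the nearest integer of `iθ` and `jθ` is, in absolute value,
the distance of `(i + j)θ` or of `(j - i)θ` from some integer. -/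
theorem abs_distInt_sub_ge {θ c : ℝ} (hc : 0 < c) (h : ∀ j : ℕ, 1 ≤ j → c / j ≤ distInt (j * θ))
    {i j : ℕ} (hi : 1 ≤ i) (hij : i < j) :
    c / (i + j : ℝ) ≤ |distInt (i * θ) - distInt (j * θ)| := by
  have hi' : (1 : ℝ) ≤ i := by exact_mod_cast hi
  have hij' : (i : ℝ) < j := by exact_mod_cast hij
  have hsub : c / (i + j : ℝ) ≤ distInt ((j - i : ℝ) * θ) := by
    have h1 := h (j - i) (by omega)
    rw [Nat.cast_sub hij.le] at h1
    refine le_trans ?_ h1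
    apply div_le_div_of_nonneg_left hc.le <;> linarith
  have hadd : c / (i + j : ℝ) ≤ distInt ((i + j : ℝ) * θ) := by
    have h1 := h (i + j) (by omega)
    rwa [Nat.cast_add] at h1
  set x := i * θ - round (i * θ) with hx
  set y := j * θ - round (j * θ) with hy
  have h1 : distInt ((j - i : ℝ) * θ) ≤ |y - x| := by
    refine (distInt_le _ (round (j * θ) - round (i * θ))).trans (le_of_eq ?_)
    rw [hx, hy]; push_cast; congr 1; ring
  have h2 : distInt ((i + j : ℝ) * θ) ≤ |x + y| := by
    refine (distInt_le _ (round (i * θ) + round (j * θ))).trans (le_of_eq ?_)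
    rw [hx, hy]; push_cast; congr 1; ring
  change _ ≤ abs (abs x - abs y)
  rcases abs_cases x with ⟨ex, -⟩ | ⟨ex, -⟩ <;> rcases abs_cases y with ⟨ey, -⟩ | ⟨ey, -⟩ <;>
    rw [ex, ey]
  · rw [abs_sub_comm]; linarith
  · rw [sub_neg_eq_add]; linarith
  · rw [← neg_add', abs_neg]; linarith
  · rw [show -x - -y = y - x by ring]; linarith

/-- The numbers `distInt (jθ)`, for `1 ≤ j ≤ K`, are `c / (2 K)`-separated, so the integers
`⌊(2 K / c) distInt (jθ)⌋` are distinct and the sum is dominated by a harmonic sum. -/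
theorem sum_inv_distInt_le {θ c : ℝ} (hc : 0 < c)
    (h : ∀ j : ℕ, 1 ≤ j → c / j ≤ distInt (j * θ)) (K : ℕ) (hK : 1 ≤ K) :
    ∑ j ∈ Icc 1 K, 1 / distInt (j * θ) ≤ 2 * K / c * (1 + Real.log (K / c)) := by
  have hK' : (1 : ℝ) ≤ K := by exact_mod_cast hK
  set A : ℝ := 2 * K / c with hA
  have hA0 : 0 < A := by positivity
  set t : ℕ → ℕ := fun j => ⌊A * distInt (j * θ)⌋₊ with ht
  have hlow : ∀ j ∈ Icc 1 K, 1 ≤ t j := by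
    intro j hj
    rw [mem_Icc] at hj
    have hj1 : (1 : ℝ) ≤ j := by exact_mod_cast hj.1
    have hjK : (j : ℝ) ≤ K := by exact_mod_cast hj.2
    refine Nat.le_floor ?_
    have h1 := h j hj.1
    have h2 : A * (c / j) ≤ A * distInt (j * θ) := by gcongr
    have h3 : 1 ≤ A * (c / j) := by
      rw [hA, div_mul_div_comm, le_div_iff₀ (by positivity)]; nlinarith
    push_cast; linarith
  have hhigh : ∀ j ∈ Icc 1 K, t j ≤ ⌊(K / c : ℝ)⌋₊ := by
    intro j _
    refine Nat.floor_mono ?_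
    have : distInt (j * θ) ≤ 1 / 2 := abs_sub_round _
    calc A * distInt (j * θ) ≤ A * (1 / 2) := by gcongr
      _ = K / c := by rw [hA]; ring
  have hinj' : ∀ i j : ℕ, 1 ≤ i → i < j → j ≤ K → t i ≠ t j := by
    intro i j hi hij hj heq
    have h1 := abs_distInt_sub_ge hc h hi hij
    have hj' : (j : ℝ) ≤ K := by exact_mod_cast hj
    have hi' : (1 : ℝ) ≤ i := by exact_mod_cast hi
    have hij' : (i : ℝ) ≤ j := by exact_mod_cast hij.le
    have h2 : |A * distInt (i * θ) - A * distInt (j * θ)| < 1 := by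
      have a1 := Nat.floor_le (mul_nonneg hA0.le (distInt_nonneg (i * θ)))
      have a2 := Nat.lt_floor_add_one (A * distInt (i * θ))
      have b1 := Nat.floor_le (mul_nonneg hA0.le (distInt_nonneg (j * θ)))
      have b2 := Nat.lt_floor_add_one (A * distInt (j * θ))
      have e : (⌊A * distInt (i * θ)⌋₊ : ℝ) = ⌊A * distInt (j * θ)⌋₊ := by exact_mod_cast heq
      rw [abs_lt]; constructor <;> linarith
    rw [← mul_sub, abs_mul, abs_of_pos hA0] at h2
    have h3 : 1 ≤ A * (c / (i + j : ℝ)) := by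
      rw [hA, div_mul_div_comm, le_div_iff₀ (by positivity)]; nlinarith
    have h4 : A * (c / (i + j : ℝ)) ≤ A * |distInt (i * θ) - distInt (j * θ)| := by gcongr
    linarith
  have hinj : Set.InjOn t (Icc 1 K : Finset ℕ) := by
    intro i hi j hj heq
    simp only [coe_Icc, Set.mem_Icc] at hi hj
    rcases lt_trichotomy i j with hl | hl | hl
    · exact absurd heq (hinj' i j hi.1 hl hj.2)
    · exact hl
    · exact absurd heq.symm (hinj' j i hj.1 hl hi.2)
  have hpt : ∀ j ∈ Icc 1 K, 1 / distInt (j * θ) ≤ A * (1 / (t j : ℝ)) := by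
    intro j hj
    have h1 : (1 : ℝ) ≤ t j := by exact_mod_cast hlow j hj
    have h2 : (t j : ℝ) ≤ A * distInt (j * θ) :=
      Nat.floor_le (mul_nonneg hA0.le (distInt_nonneg _))
    have h3 : 0 < distInt (j * θ) := pos_of_mul_pos_right (by linarith) hA0.le
    rw [mul_one_div, div_le_div_iff₀ h3 (by linarith)]
    linarith
  calc ∑ j ∈ Icc 1 K, 1 / distInt (j * θ)
      ≤ ∑ j ∈ Icc 1 K, A * (1 / (t j : ℝ)) := sum_le_sum hpt
    _ = A * ∑ i ∈ (Icc 1 K).image t, 1 / (i : ℝ) := by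
        rw [sum_image hinj, mul_sum]
    _ ≤ A * ∑ i ∈ Icc 1 ⌊(K / c : ℝ)⌋₊, 1 / (i : ℝ) := by
        refine mul_le_mul_of_nonneg_left ?_ hA0.le
        refine sum_le_sum_of_subset_of_nonneg ?_ fun _ _ _ => by positivity
        intro i hi
        obtain ⟨j, hj, rfl⟩ := mem_image.mp hi
        exact mem_Icc.mpr ⟨hlow j hj, hhigh j hj⟩
    _ ≤ A * (1 + Real.log (K / c)) := by
        refine mul_le_mul_of_nonneg_left ?_ hA0.le
        have h1 := harmonic_floor_le_one_add_log (K / c : ℝ) (by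
          have e1 := hlow 1 (by simp [hK])
          have e2 := hhigh 1 (by simp [hK])
          by_contra! hlt
          have := Nat.floor_eq_zero.mpr hlt
          omega)
        rw [harmonic_eq_sum_Icc] at h1
        push_cast at h1
        simpa [one_div] using h1

/-! ### Exponential sums in residue classes modulo four -/

theorem norm_expE (x : ℝ) : ‖expE x‖ = 1 := by
  rw [expE, show (2 * Real.pi * Complex.I * x : ℂ) = ((2 * Real.pi * x : ℝ) : ℂ) * Complex.I by
    push_cast; ring]
  exact Complex.norm_exp_ofReal_mul_I _

theorem expE_add (x y : ℝ) : expE (x + y) = expE x * expE y := by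
  rw [expE, expE, expE, ← Complex.exp_add]; push_cast; ring_nf

theorem expE_nat_mul (j : ℕ) (x : ℝ) : expE (j * x) = expE x ^ j := by
  rw [expE, expE, ← Complex.exp_nat_mul]; push_cast; ring_nf

theorem conj_expE (x : ℝ) : (starRingEnd ℂ) (expE x) = expE (-x) := by
  rw [expE, expE, ← Complex.exp_conj]
  simp [Complex.conj_ofNat]

theorem four_mul_distInt_le (x : ℝ) : 4 * distInt x ≤ ‖expE x - 1‖ := by
  have h0 : expE x = expE (x - round x) := by
    rw [expE, expE]
    refine Complex.exp_eq_exp_iff_exists_int.mpr ⟨round x, ?_⟩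
    push_cast; ring
  rw [h0]
  unfold distInt
  set y := x - round x
  have hy : |y| ≤ 1 / 2 := abs_sub_round x
  rw [expE, show (2 * Real.pi * Complex.I * y : ℂ) = Complex.I * ((2 * Real.pi * y : ℝ) : ℂ) by
    push_cast; ring, Complex.norm_exp_I_mul_ofReal_sub_one, norm_mul, Real.norm_ofNat,
    Real.norm_eq_abs, show 2 * Real.pi * y / 2 = Real.pi * y by ring]
  have hsin : |Real.sin (Real.pi * y)| = Real.sin (Real.pi * |y|) := by
    have h1 : 0 ≤ Real.sin (Real.pi * |y|) :=
      Real.sin_nonneg_of_nonneg_of_le_pi (by positivity) (by nlinarith [Real.pi_pos])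
    rcases abs_cases y with ⟨e, -⟩ | ⟨e, -⟩ <;> rw [e] at h1 ⊢
    · exact abs_of_nonneg h1
    · rw [mul_neg, Real.sin_neg] at h1 ⊢
      exact abs_of_nonpos (by linarith)
  rw [hsin]
  have h2 := Real.mul_le_sin (x := Real.pi * |y|) (by positivity) (by nlinarith [Real.pi_pos])
  have h3 : 2 / Real.pi * (Real.pi * |y|) = 2 * |y| := by
    field_simp
  linarith

/-- A geometric sum of ratio `w ^ 4`; the exponent `r + 4 * j` is the least one of its class that is
at least `M`. -/
theorem sum_mod_four_mul (w : ℂ) (r : ℕ) (hr : r < 4) (M : ℕ) :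
    ∃ j : ℕ, (∑ l ∈ range M with l % 4 = r, w ^ l) * (w ^ 4 - 1) = w ^ (r + 4 * j) - w ^ r ∧
      M ≤ r + 4 * j ∧ r + 4 * j < M + 4 := by
  induction M with
  | zero => exact ⟨0, by simp, by omega, by omega⟩
  | succ M ih =>
    obtain ⟨j, h1, h2, h3⟩ := ih
    rw [range_add_one, filter_insert]
    split_ifs with h
    · refine ⟨j + 1, ?_, by omega, by omega⟩
      have hM : M = r + 4 * j := by omega
      rw [sum_insert (by simp), add_mul, h1, hM]; ring
    · exact ⟨j, h1, by omega, by omega⟩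

theorem norm_sum_mod_four_le (x : ℝ) (r M : ℕ) (hr : r ≠ 0) (hx : 0 < distInt (4 * x)) :
    ‖∑ l ∈ Icc 1 M with l % 4 = r, expE (l * x)‖ ≤ 1 / (2 * distInt (4 * x)) := by
  by_cases hr4 : r < 4
  · have h0 : (Icc 1 M).filter (fun l => l % 4 = r) = (range (M + 1)).filter (fun l => l % 4 = r) := by
      ext l; simp only [mem_filter, mem_Icc, mem_range]; omega
    obtain ⟨j, hj, -⟩ := sum_mod_four_mul (expE x) r hr4 (M + 1)
    have h4 : expE x ^ 4 = expE (4 * x) := by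
      have := expE_nat_mul 4 x
      push_cast at this; exact this.symm
    rw [h0]
    simp_rw [expE_nat_mul]
    rw [h4] at hj
    have hn := congrArg norm hj
    rw [norm_mul] at hn
    have h2 : ‖expE x ^ (r + 4 * j) - expE x ^ r‖ ≤ 2 := by
      refine (norm_sub_le _ _).trans ?_
      simp [norm_expE]; norm_num
    have h3 := four_mul_distInt_le (4 * x)
    set S := ‖∑ l ∈ range (M + 1) with l % 4 = r, expE x ^ l‖
    have hS : 0 ≤ S := norm_nonneg _
    rw [le_div_iff₀ (by positivity)]
    nlinarith
  · rw [filter_false_of_mem (fun l _ => by omega)]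
    simp; positivity

/-! ### Bilinear forms -/

/-- The operator norm of a bilinear form is bounded through its Gram matrix, whose norm is at most
its largest absolute row sum (Cauchy's inequality, then Schur's test). -/
theorem norm_bilinear_le_of_gram {ι κ : Type*} (s : Finset ι) (t : Finset κ) (Φ : ι → κ → ℂ)
    (G : ι → ι → ℝ) (hsymm : ∀ i i', G i i' = G i' i)
    (hG : ∀ i ∈ s, ∀ i' ∈ s, ‖∑ j ∈ t, Φ i j * (starRingEnd ℂ) (Φ i' j)‖ ≤ G i i')
    {Y : ℝ} (hY : ∀ i ∈ s, ∑ i' ∈ s, G i i' ≤ Y) (a : ι → ℂ) (b : κ → ℂ) :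
    ‖∑ i ∈ s, ∑ j ∈ t, a i * b j * Φ i j‖
      ≤ √Y * √(∑ i ∈ s, ‖a i‖ ^ 2) * √(∑ j ∈ t, ‖b j‖ ^ 2) := by
  have h1 : ∑ i ∈ s, ∑ j ∈ t, a i * b j * Φ i j = ∑ j ∈ t, b j * ∑ i ∈ s, a i * Φ i j := by
    rw [sum_comm]
    refine sum_congr rfl fun j _ => ?_
    rw [mul_sum]
    exact sum_congr rfl fun i _ => by ring
  have h2 : ((∑ j ∈ t, ‖∑ i ∈ s, a i * Φ i j‖ ^ 2 : ℝ) : ℂ)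
      = ∑ i ∈ s, ∑ i' ∈ s, a i * (starRingEnd ℂ) (a i') *
          ∑ j ∈ t, Φ i j * (starRingEnd ℂ) (Φ i' j) := by
    push_cast
    simp_rw [← Complex.mul_conj', map_sum, sum_mul_sum, mul_sum, map_mul]
    rw [sum_comm]
    refine sum_congr rfl fun i _ => ?_
    rw [sum_comm]
    exact sum_congr rfl fun i' _ => sum_congr rfl fun j _ => by ring
  have h3 : ∑ j ∈ t, ‖∑ i ∈ s, a i * Φ i j‖ ^ 2 ≤ Y * ∑ i ∈ s, ‖a i‖ ^ 2 := by
    have hnn : 0 ≤ ∑ j ∈ t, ‖∑ i ∈ s, a i * Φ i j‖ ^ 2 := sum_nonneg fun _ _ => by positivity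
    calc ∑ j ∈ t, ‖∑ i ∈ s, a i * Φ i j‖ ^ 2
        = ‖((∑ j ∈ t, ‖∑ i ∈ s, a i * Φ i j‖ ^ 2 : ℝ) : ℂ)‖ := by
          rw [Complex.norm_real, Real.norm_of_nonneg hnn]
      _ ≤ ∑ i ∈ s, ∑ i' ∈ s, (‖a i‖ ^ 2 / 2 * G i i' + ‖a i'‖ ^ 2 / 2 * G i' i) := by
          rw [h2]
          refine (norm_sum_le _ _).trans (sum_le_sum fun i hi => ?_)
          refine (norm_sum_le _ _).trans (sum_le_sum fun i' hi' => ?_)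
          rw [norm_mul, norm_mul, RCLike.norm_conj, hsymm i' i]
          have hg := hG i hi i' hi'
          have h0 : 0 ≤ G i i' := (norm_nonneg _).trans hg
          calc _ ≤ ‖a i‖ * ‖a i'‖ * G i i' := by gcongr
            _ ≤ _ := by nlinarith [mul_nonneg h0 (sq_nonneg (‖a i‖ - ‖a i'‖))]
      _ = ∑ i ∈ s, ‖a i‖ ^ 2 * ∑ i' ∈ s, G i i' := by
          simp_rw [sum_add_distrib]
          rw [sum_comm (f := fun i i' => ‖a i'‖ ^ 2 / 2 * G i' i), ← sum_add_distrib]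
          refine sum_congr rfl fun i _ => ?_
          rw [← mul_sum]; ring
      _ ≤ ∑ i ∈ s, ‖a i‖ ^ 2 * Y := sum_le_sum fun i hi =>
          mul_le_mul_of_nonneg_left (hY i hi) (by positivity)
      _ = _ := by rw [← sum_mul, mul_comm]
  rw [h1]
  calc ‖∑ j ∈ t, b j * ∑ i ∈ s, a i * Φ i j‖
      ≤ ∑ j ∈ t, ‖b j‖ * ‖∑ i ∈ s, a i * Φ i j‖ :=
        (norm_sum_le _ _).trans (le_of_eq (sum_congr rfl fun _ _ => norm_mul _ _))
    _ ≤ √(∑ j ∈ t, ‖b j‖ ^ 2) * √(∑ j ∈ t, ‖∑ i ∈ s, a i * Φ i j‖ ^ 2) :=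
        Real.sum_mul_le_sqrt_mul_sqrt _ _ _
    _ ≤ √(∑ j ∈ t, ‖b j‖ ^ 2) * √(Y * ∑ i ∈ s, ‖a i‖ ^ 2) := by gcongr
    _ = _ := by rw [Real.sqrt_mul' _ (sum_nonneg fun _ _ => by positivity)]; ring

/-- Triangular truncation: imposing `P i ≤ Q j` on a bilinear form multiplies the bound for its norm
by at most `J + 1`, if `P` and `Q` take at most `2 ^ J` values. The induction splits by the leading
binary digits of `P i` and `Q j`: if they differ, the inequality is decided and leaves one full
bilinear form; if they agree, there remain two truncated forms with disjoint variables. -/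
theorem norm_triangular_bilinear_le {ι κ : Type*} (s : Finset ι) (t : Finset κ) (Φ : ι → κ → ℂ)
    {X : ℝ} (hX : 0 ≤ X)
    (h : ∀ (a : ι → ℂ) (b : κ → ℂ), ‖∑ i ∈ s, ∑ j ∈ t, a i * b j * Φ i j‖
      ≤ X * √(∑ i ∈ s, ‖a i‖ ^ 2) * √(∑ j ∈ t, ‖b j‖ ^ 2)) (J : ℕ) :
    ∀ (P : ι → ℕ) (Q : κ → ℕ), (∀ i, P i < 2 ^ J) → (∀ j, Q j < 2 ^ J) →
      ∀ (a : ι → ℂ) (b : κ → ℂ),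
        ‖∑ i ∈ s, ∑ j ∈ t, a i * b j * (if P i ≤ Q j then Φ i j else 0)‖
          ≤ (J + 1) * (X * √(∑ i ∈ s, ‖a i‖ ^ 2) * √(∑ j ∈ t, ‖b j‖ ^ 2)) := by
  induction J with
  | zero =>
    intro P Q hP hQ a b
    simp only [pow_zero, Nat.lt_one_iff] at hP hQ
    simpa [hP, hQ] using h a b
  | succ J ih =>
    intro P Q hP hQ a b
    set a0 : ι → ℂ := fun i => if P i < 2 ^ J then a i else 0 with ha0
    set a1 : ι → ℂ := fun i => if P i < 2 ^ J then 0 else a i with ha1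
    set b0 : κ → ℂ := fun j => if Q j < 2 ^ J then b j else 0 with hb0
    set b1 : κ → ℂ := fun j => if Q j < 2 ^ J then 0 else b j with hb1
    have hpos : 0 < 2 ^ J := by positivity
    have hmod : ∀ x : ℕ, x < 2 ^ (J + 1) → x % 2 ^ J = if x < 2 ^ J then x else x - 2 ^ J := by
      intro x hx
      split_ifs with hlt
      · exact Nat.mod_eq_of_lt hlt
      · rw [Nat.mod_eq_sub_mod (by omega), Nat.mod_eq_of_lt (by rw [pow_succ] at hx; omega)]
    have hsplit : ∑ i ∈ s, ∑ j ∈ t, a i * b j * (if P i ≤ Q j then Φ i j else 0)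
        = ∑ i ∈ s, ∑ j ∈ t, a0 i * b0 j * (if P i % 2 ^ J ≤ Q j % 2 ^ J then Φ i j else 0)
          + ∑ i ∈ s, ∑ j ∈ t, a1 i * b1 j * (if P i % 2 ^ J ≤ Q j % 2 ^ J then Φ i j else 0)
          + ∑ i ∈ s, ∑ j ∈ t, a0 i * b1 j * Φ i j := by
      simp_rw [← sum_add_distrib]
      refine sum_congr rfl fun i _ => sum_congr rfl fun j _ => ?_
      rw [hmod _ (hP i), hmod _ (hQ j)]
      simp only [ha0, ha1, hb0, hb1]
      by_cases hp : P i < 2 ^ J <;> by_cases hq : Q j < 2 ^ J <;> simp only [hp, hq, if_true, if_false]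
      · ring
      · rw [if_pos (by omega)]; ring
      · rw [if_neg (by omega)]; ring
      · have : P i - 2 ^ J ≤ Q j - 2 ^ J ↔ P i ≤ Q j := by omega
        simp only [this]; ring
    have hA : ∑ i ∈ s, ‖a i‖ ^ 2 = ∑ i ∈ s, ‖a0 i‖ ^ 2 + ∑ i ∈ s, ‖a1 i‖ ^ 2 := by
      rw [← sum_add_distrib]
      refine sum_congr rfl fun i _ => ?_
      simp only [ha0, ha1]; split_ifs <;> simp
    have hB : ∑ j ∈ t, ‖b j‖ ^ 2 = ∑ j ∈ t, ‖b0 j‖ ^ 2 + ∑ j ∈ t, ‖b1 j‖ ^ 2 := by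
      rw [← sum_add_distrib]
      refine sum_congr rfl fun j _ => ?_
      simp only [hb0, hb1]; split_ifs <;> simp
    have hPm : ∀ i, P i % 2 ^ J < 2 ^ J := fun i => Nat.mod_lt _ hpos
    have hQm : ∀ j, Q j % 2 ^ J < 2 ^ J := fun j => Nat.mod_lt _ hpos
    have e0 := ih (fun i => P i % 2 ^ J) (fun j => Q j % 2 ^ J) hPm hQm a0 b0
    have e1 := ih (fun i => P i % 2 ^ J) (fun j => Q j % 2 ^ J) hPm hQm a1 b1
    have e2 := h a0 b1
    rw [hsplit, hA, hB]
    refine (norm_add₃_le).trans ?_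
    set A0 := ∑ i ∈ s, ‖a0 i‖ ^ 2
    set A1 := ∑ i ∈ s, ‖a1 i‖ ^ 2
    set B0 := ∑ j ∈ t, ‖b0 j‖ ^ 2
    set B1 := ∑ j ∈ t, ‖b1 j‖ ^ 2
    have hA0 : 0 ≤ A0 := sum_nonneg fun _ _ => by positivity
    have hA1 : 0 ≤ A1 := sum_nonneg fun _ _ => by positivity
    have hB0 : 0 ≤ B0 := sum_nonneg fun _ _ => by positivity
    have hB1 : 0 ≤ B1 := sum_nonneg fun _ _ => by positivity
    -- Cauchy's inequality: the two diagonal blocks together cost no more than one form.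
    have c1 : √A0 * √B0 + √A1 * √B1 ≤ √(A0 + A1) * √(B0 + B1) := by
      rw [← Real.sqrt_mul (add_nonneg hA0 hA1)]
      apply Real.le_sqrt_of_sq_le
      have s1 := Real.sq_sqrt hA0
      have s2 := Real.sq_sqrt hA1
      have s3 := Real.sq_sqrt hB0
      have s4 := Real.sq_sqrt hB1
      set p := √A0
      set q := √A1
      set u := √B0
      set v := √B1
      rw [← s1, ← s2, ← s3, ← s4]
      nlinarith [sq_nonneg (p * v - q * u)]
    have c2 : √A0 * √B1 ≤ √(A0 + A1) * √(B0 + B1) := by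
      gcongr <;> linarith
    push_cast
    calc _ ≤ ((J : ℝ) + 1) * (X * √A0 * √B0) + ((J : ℝ) + 1) * (X * √A1 * √B1)
          + X * √A0 * √B1 := by linarith
      _ = ((J : ℝ) + 1) * X * (√A0 * √B0 + √A1 * √B1) + X * (√A0 * √B1) := by ring
      _ ≤ ((J : ℝ) + 1) * X * (√(A0 + A1) * √(B0 + B1)) + X * (√(A0 + A1) * √(B0 + B1)) := by
          gcongr
      _ = _ := by ring

/-! ### The exponential kernel -/

/-- The number `e(k l √2)` where `k l ≤ n` and `k l ≡ 1 mod 4`, and zero elsewhere. -/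
noncomputable def expKernel (n k l : ℕ) : ℂ :=
  if k * l ≤ n ∧ (k * l) % 4 = 1 then expE ((k * l : ℕ) * Real.sqrt 2) else 0

theorem norm_expKernel_le_one (n k l : ℕ) : ‖expKernel n k l‖ ≤ 1 := by
  unfold expKernel
  split_ifs
  · exact (norm_expE _).le
  · simp

theorem trigS_sqrt_two_eq (N : ℝ) :
    trigS (Real.sqrt 2) N = ∑ k ∈ Icc 1 ⌊N⌋₊, ∑ l ∈ Icc 1 ⌊N⌋₊,
      (sieveWeight ⌊N⌋₊ k l : ℂ) * expKernel ⌊N⌋₊ k l := by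
  generalize hn : ⌊N⌋₊ = n
  rw [trigS, hn]
  have h := sum_sum_divisors n (fun k l => if (k * l) % 4 = 1 then
    (sieveWeight n k l : ℂ) * expE ((k * l : ℕ) * Real.sqrt 2) else 0)
  refine Eq.trans (sum_congr rfl fun m hm => ?_) (h.trans ?_)
  · rw [mem_Icc] at hm
    rw [gaussB_eq_sum_sieveWeight (by omega) hm.2, sum_mul]
    refine sum_congr rfl fun d hd => ?_
    rw [Nat.mul_div_cancel' (Nat.dvd_of_mem_divisors hd), ite_mul, zero_mul]
  · refine sum_congr rfl fun k _ => sum_congr rfl fun l _ => ?_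
    unfold expKernel
    by_cases h1 : k * l ≤ n <;> by_cases h2 : (k * l) % 4 = 1 <;> simp [h1, h2]

theorem mul_mod_four_eq_one_iff (k l : ℕ) :
    (k * l) % 4 = 1 ↔ l % 4 = k % 4 ∧ k % 2 = 1 := by
  have h2 : k % 2 = k % 4 % 2 := by omega
  rw [Nat.mul_mod, h2]
  have hk := Nat.mod_lt k (by norm_num : 4 > 0)
  have hl := Nat.mod_lt l (by norm_num : 4 > 0)
  generalize k % 4 = x at *
  generalize l % 4 = y at *
  interval_cases x <;> interval_cases y <;> simp

theorem norm_sum_expKernel_le {n k : ℕ} (hk : 1 ≤ k) :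
    ‖∑ l ∈ Icc 1 n, expKernel n k l‖ ≤ 8 * k := by
  have hk' : (1 : ℝ) ≤ k := by exact_mod_cast hk
  unfold expKernel
  rw [← sum_filter]
  by_cases h2 : k % 2 = 1
  · have hset : (Icc 1 n).filter (fun l => k * l ≤ n ∧ (k * l) % 4 = 1)
        = (Icc 1 (n / k)).filter (fun l => l % 4 = k % 4) := by
      ext l
      simp only [mem_filter, mem_Icc, mul_mod_four_eq_one_iff, h2, and_true,
        Nat.le_div_iff_mul_le hk, mul_comm l k]
      constructor
      · rintro ⟨⟨h1, -⟩, h3, h4⟩; exact ⟨⟨h1, h3⟩, h4⟩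
      · rintro ⟨⟨h1, h3⟩, h4⟩; exact ⟨⟨h1, by nlinarith⟩, h3, h4⟩
    have hd := distInt_mul_four_sqrt_two hk
    rw [show (k : ℝ) * (4 * Real.sqrt 2) = 4 * (k * Real.sqrt 2) by ring] at hd
    have hpos : 0 < distInt (4 * (k * Real.sqrt 2)) := lt_of_lt_of_le (by positivity) hd
    have h := norm_sum_mod_four_le (k * Real.sqrt 2) (k % 4) (n / k) (by omega) hpos
    rw [hset]
    simp_rw [Nat.cast_mul, mul_comm (k : ℝ) _, mul_assoc]
    refine h.trans ?_
    rw [div_le_iff₀ (by positivity)]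
    rw [div_le_iff₀ (by positivity)] at hd
    linarith
  · rw [filter_false_of_mem fun l _ h => h2 ((mul_mod_four_eq_one_iff k l).mp h.2).2]
    simp

/-- In natural numbers `k - k' + (k' - k)` is `|k - k'|`. -/
theorem distInt_four_sqrt_two_sub {k k' : ℕ} :
    distInt (4 * (((k : ℝ) - k') * Real.sqrt 2))
      = distInt (((k - k' + (k' - k) : ℕ) : ℝ) * (4 * Real.sqrt 2)) := by
  rcases le_total k k' with h | h
  · rw [Nat.sub_eq_zero_of_le h, zero_add, Nat.cast_sub h, ← distInt_neg]
    congr 1; ring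
  · rw [Nat.sub_eq_zero_of_le h, add_zero, Nat.cast_sub h]
    congr 1; ring

/-- For fixed `k ≠ k'` the correlation is a geometric sum over `l ≡ k mod 4`, or is empty. -/
theorem norm_gram_expKernel_le {n K k k' : ℕ} (hK : 1 ≤ K) (hk : K ≤ k)
    (hne : k ≠ k') :
    ‖∑ l ∈ Icc 1 (n / K), expKernel n k l * (starRingEnd ℂ) (expKernel n k' l)‖
      ≤ 1 / (2 * distInt (((k - k' + (k' - k) : ℕ) : ℝ) * (4 * Real.sqrt 2))) := by
  have hj : 1 ≤ k - k' + (k' - k) := by omega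
  have hd := distInt_mul_four_sqrt_two hj
  have hpos : 0 < distInt (((k - k' + (k' - k) : ℕ) : ℝ) * (4 * Real.sqrt 2)) := by
    refine lt_of_lt_of_le ?_ hd
    have : (0 : ℝ) < ((k - k' + (k' - k) : ℕ) : ℝ) := by exact_mod_cast hj
    positivity
  have hterm : ∀ l, expKernel n k l * (starRingEnd ℂ) (expKernel n k' l)
      = if ((k * l ≤ n ∧ k' * l ≤ n) ∧ (k * l) % 4 = 1 ∧ (k' * l) % 4 = 1)
        then expE (l * (((k : ℝ) - k') * Real.sqrt 2)) else 0 := by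
    intro l
    unfold expKernel
    by_cases h1 : k * l ≤ n ∧ (k * l) % 4 = 1
    · by_cases h2 : k' * l ≤ n ∧ (k' * l) % 4 = 1
      · rw [if_pos h1, if_pos h2, if_pos ⟨⟨h1.1, h2.1⟩, h1.2, h2.2⟩, conj_expE, ← expE_add]
        congr 1; push_cast; ring
      · have h3 : ¬ ((k * l ≤ n ∧ k' * l ≤ n) ∧ (k * l) % 4 = 1 ∧ (k' * l) % 4 = 1) :=
          fun h => h2 ⟨h.1.2, h.2.2⟩
        rw [if_neg h2, if_neg h3, map_zero, mul_zero]
    · have h3 : ¬ ((k * l ≤ n ∧ k' * l ≤ n) ∧ (k * l) % 4 = 1 ∧ (k' * l) % 4 = 1) :=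
        fun h => h1 ⟨h.1.1, h.2.1⟩
      rw [if_neg h1, if_neg h3, zero_mul]
  simp_rw [hterm]
  rw [← sum_filter]
  by_cases hc : k % 4 = k' % 4 ∧ k % 2 = 1
  · have hset : (Icc 1 (n / K)).filter
        (fun l => (k * l ≤ n ∧ k' * l ≤ n) ∧ (k * l) % 4 = 1 ∧ (k' * l) % 4 = 1)
        = (Icc 1 (n / max k k')).filter (fun l => l % 4 = k % 4) := by
      ext l
      have hmax : l ≤ n / max k k' ↔ k * l ≤ n ∧ k' * l ≤ n := by
        rw [Nat.le_div_iff_mul_le (lt_max_of_lt_left (lt_of_lt_of_le hK hk)), mul_comm]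
        rcases le_total k k' with h | h
        · rw [max_eq_right h]
          exact ⟨fun h' => ⟨(Nat.mul_le_mul_right l h).trans h', h'⟩, fun h' => h'.2⟩
        · rw [max_eq_left h]
          exact ⟨fun h' => ⟨h', (Nat.mul_le_mul_right l h).trans h'⟩, fun h' => h'.1⟩
      have hlK : k * l ≤ n → l ≤ n / K := fun h => by
        rw [Nat.le_div_iff_mul_le hK, mul_comm]
        exact (Nat.mul_le_mul_right l hk).trans h
      simp only [mem_filter, mem_Icc, mul_mod_four_eq_one_iff, hmax]
      constructor
      · rintro ⟨⟨h1, -⟩, h2, h3, -⟩; exact ⟨⟨h1, h2⟩, h3.1⟩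
      · rintro ⟨⟨h1, h2⟩, h3⟩
        exact ⟨⟨h1, hlK h2.1⟩, h2, ⟨h3, hc.2⟩, by omega, by omega⟩
    rw [hset, ← distInt_four_sqrt_two_sub]
    rw [← distInt_four_sqrt_two_sub] at hpos
    exact norm_sum_mod_four_le _ _ _ (by omega) hpos
  · rw [filter_false_of_mem fun l _ h => hc (by
      have h1 := (mul_mod_four_eq_one_iff k l).mp h.2.1
      have h2 := (mul_mod_four_eq_one_iff k' l).mp h.2.2
      omega)]
    simp only [sum_empty, norm_zero]
    positivity

/-- Each nonzero `|k - k'|` occurs for at most two `k'`, and is at most `K`. -/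
theorem sum_abs_sub_le {g : ℕ → ℝ} (hg : ∀ j, 0 ≤ g j) {M : ℝ} {K k : ℕ}
    (hk : k ∈ Ico K (2 * K)) :
    ∑ k' ∈ Ico K (2 * K), (if k = k' then M else g (k - k' + (k' - k)))
      ≤ M + 2 * ∑ j ∈ Icc 1 K, g j := by
  have hk' := mem_Ico.mp hk
  have h1 : ∀ k' ∈ Ico K (2 * K), (if k = k' then M else g (k - k' + (k' - k)))
      = (if k = k' then M else 0) + ((if k' < k then g (k - k') else 0)
        + (if k < k' then g (k' - k) else 0)) := by
    intro k' _
    rcases lt_trichotomy k k' with h | h | h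
    · rw [if_neg h.ne, if_neg h.ne, if_neg (by omega), if_pos h, Nat.sub_eq_zero_of_le h.le]; simp
    · simp [h]
    · rw [if_neg h.ne', if_neg h.ne', if_pos h, if_neg (by omega), Nat.sub_eq_zero_of_le h.le]; simp
  have hsub : ∀ (t : Finset ℕ) (f : ℕ → ℕ), Set.InjOn f t → (∀ x ∈ t, f x ∈ Icc 1 K) →
      ∑ x ∈ t, g (f x) ≤ ∑ j ∈ Icc 1 K, g j := by
    intro t f hf hm
    rw [← sum_image hf]
    refine sum_le_sum_of_subset_of_nonneg ?_ fun _ _ _ => hg _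
    intro j hj
    obtain ⟨x, hx, rfl⟩ := mem_image.mp hj
    exact hm x hx
  rw [sum_congr rfl h1, sum_add_distrib, sum_add_distrib, sum_ite_eq, if_pos hk, ← sum_filter,
    ← sum_filter, two_mul (∑ j ∈ Icc 1 K, g j)]
  refine add_le_add le_rfl (add_le_add (hsub _ (fun x => k - x) ?_ ?_) (hsub _ (fun x => x - k) ?_ ?_))
  · intro x hx y hy h
    simp only [coe_filter, mem_Ico, Set.mem_ofPred_eq] at hx hy h
    omega
  · intro x hx
    simp only [mem_filter, mem_Ico, mem_Icc] at hx ⊢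
    omega
  · intro x hx y hy h
    simp only [coe_filter, mem_Ico, Set.mem_ofPred_eq] at hx hy h
    omega
  · intro x hx
    simp only [mem_filter, mem_Ico, mem_Icc] at hx ⊢
    omega

theorem norm_dyadic_bilinear_le {n K : ℕ} (hK : 1 ≤ K) (a b : ℕ → ℂ) :
    ‖∑ k ∈ Ico K (2 * K), ∑ l ∈ Icc 1 (n / K), a k * b l * expKernel n k l‖
      ≤ √((n / K : ℝ) + 32 * K * (1 + Real.log (16 * K))) *
        √(∑ k ∈ Ico K (2 * K), ‖a k‖ ^ 2) * √(∑ l ∈ Icc 1 (n / K), ‖b l‖ ^ 2) := by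
  set g : ℕ → ℝ := fun j => 1 / (2 * distInt (j * (4 * Real.sqrt 2))) with hg
  have hg0 : ∀ j, 0 ≤ g j := fun j => by
    have := distInt_nonneg (j * (4 * Real.sqrt 2))
    simp only [hg]; positivity
  refine norm_bilinear_le_of_gram _ _ _
    (fun k k' => if k = k' then (n / K : ℝ) else g (k - k' + (k' - k))) ?_ ?_ ?_ a b
  · intro k k'
    simp only [eq_comm (a := k), add_comm (k - k')]
  · intro k hk k' _
    rw [mem_Ico] at hk
    by_cases h : k = k'
    · rw [if_pos h]
      refine (norm_sum_le_of_le (n := fun _ => (1 : ℝ)) _ fun l _ => ?_).trans ?_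
      · rw [norm_mul, RCLike.norm_conj]
        exact mul_le_one₀ (norm_expKernel_le_one _ _ _) (norm_nonneg _) (norm_expKernel_le_one _ _ _)
      · simpa using (Nat.cast_div_le : ((n / K : ℕ) : ℝ) ≤ n / K)
    · rw [if_neg h]
      exact norm_gram_expKernel_le hK hk.1 h
  · intro k hk
    refine (sum_abs_sub_le hg0 hk).trans (add_le_add le_rfl ?_)
    have h := sum_inv_distInt_le (θ := 4 * Real.sqrt 2) (c := 1 / 16) (by norm_num) (fun j hj => by
      have := distInt_mul_four_sqrt_two hj
      rwa [div_div]) K hK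
    have e : 2 * ∑ j ∈ Icc 1 K, g j = ∑ j ∈ Icc 1 K, 1 / distInt (j * (4 * Real.sqrt 2)) := by
      rw [mul_sum]
      refine sum_congr rfl fun j _ => ?_
      simp only [hg]
      rw [one_div, one_div, mul_inv, ← mul_assoc]; norm_num
    rw [e]
    refine h.trans (le_of_eq ?_)
    rw [show (K : ℝ) / (1 / 16) = 16 * K by ring]; ring

/-! ### The linear and the bilinear sum -/

open scoped Classical in
/-- The least prime factor `p ≡ 3 mod 4` of `l`, capped at `n`, and `n` if there is none. The cap keeps
the values in a bounded range and does not affect comparisons with numbers up to `n`. -/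
noncomputable def leastPrimeThree (n l : ℕ) : ℕ :=
  if h : ∃ p : ℕ, p.Prime ∧ p % 4 = 3 ∧ p ∣ l then min n (Nat.find h) else n

theorem leastPrimeThree_le (n l : ℕ) : leastPrimeThree n l ≤ n := by
  unfold leastPrimeThree
  split_ifs
  · exact min_le_left _ _
  · exact le_rfl

theorem noSmaller_iff {n k l : ℕ} (hk : 1 ≤ k) (hkn : k ≤ n) :
    NoSmaller k l ↔ k.minFac ≤ leastPrimeThree n l := by
  classical
  have hkn' : k.minFac ≤ n := (Nat.minFac_le hk).trans hkn
  unfold leastPrimeThree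
  split_ifs with h
  · rw [le_min_iff]
    constructor
    · intro hno
      obtain ⟨h1, h2, h3⟩ := Nat.find_spec h
      exact ⟨hkn', hno _ h1 h2 h3⟩
    · rintro ⟨-, hle⟩ p h1 h2 h3
      exact hle.trans (Nat.find_min' h ⟨h1, h2, h3⟩)
  · exact ⟨fun _ => hkn', fun _ p h1 h2 h3 => absurd ⟨p, h1, h2, h3⟩ h⟩

open scoped Classical in
/-- The sieve weight of the divisors that stay below `n ^ (1 / 3)`. -/
noncomputable def smallWeight (n k : ℕ) : ℂ :=
  if IsSieveModulus n k ∧ k ^ 3 ≤ n then (ArithmeticFunction.moebius k : ℂ) else 0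

open scoped Classical in
/-- The sieve weight of the divisors that cross `n ^ (1 / 3)`, without the coupling condition on the
cofactor. -/
noncomputable def crossingWeight (n k : ℕ) : ℂ :=
  if IsSieveModulus n k ∧ IsCrossing n k then (ArithmeticFunction.moebius k : ℂ) else 0

theorem norm_moebius_le_one (k : ℕ) : ‖(ArithmeticFunction.moebius k : ℂ)‖ ≤ 1 := by
  rw [Complex.norm_intCast]
  exact_mod_cast ArithmeticFunction.abs_moebius_le_one

theorem norm_smallWeight_le_one (n k : ℕ) : ‖smallWeight n k‖ ≤ 1 := by
  unfold smallWeight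
  split_ifs
  · exact norm_moebius_le_one k
  · simp

theorem norm_crossingWeight_le_one (n k : ℕ) : ‖crossingWeight n k‖ ≤ 1 := by
  unfold crossingWeight
  split_ifs
  · exact norm_moebius_le_one k
  · simp

theorem sieveWeight_eq {n k l : ℕ} (hk : 1 ≤ k) (hkn : k ≤ n) :
    (sieveWeight n k l : ℂ) = smallWeight n k
      + crossingWeight n k * (if k.minFac ≤ leastPrimeThree n l then 1 else 0) := by
  unfold sieveWeight smallWeight crossingWeight
  have hiff := (noSmaller_iff (l := l) hk hkn).symm
  by_cases h1 : IsSieveModulus n k <;> by_cases h2 : k ^ 3 ≤ n <;>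
    by_cases h3 : IsCrossing n k <;> by_cases h4 : NoSmaller k l <;> simp [h1, h2, h3, h4, hiff]
  all_goals exact absurd h3.1 (by omega)

theorem norm_sum_smallWeight_le (n : ℕ) :
    ‖∑ k ∈ Icc 1 n, ∑ l ∈ Icc 1 n, smallWeight n k * expKernel n k l‖
      ≤ 8 * ((n : ℝ) ^ (1 / 3 : ℝ)) ^ 2 := by
  set y : ℝ := (n : ℝ) ^ (1 / 3 : ℝ) with hy
  have hy0 : 0 ≤ y := by positivity
  have hy3 : y ^ 3 = n := by
    rw [hy, ← Real.rpow_natCast, ← Real.rpow_mul (by positivity)]; norm_num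
  have hle : ∀ k : ℕ, k ^ 3 ≤ n → (k : ℝ) ≤ y := by
    intro k hk
    have : (k : ℝ) ^ 3 ≤ y ^ 3 := by rw [hy3]; exact_mod_cast hk
    exact (pow_le_pow_iff_left₀ (by positivity) hy0 (by norm_num)).mp this
  have h1 : ∀ k ∈ Icc 1 n, ‖∑ l ∈ Icc 1 n, smallWeight n k * expKernel n k l‖
      ≤ if k ^ 3 ≤ n then 8 * y else 0 := by
    intro k hk
    rw [← mul_sum, norm_mul]
    split_ifs with h
    · have a1 := norm_sum_expKernel_le (n := n) (mem_Icc.mp hk).1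
      have a2 := norm_smallWeight_le_one n k
      have a3 := hle k h
      calc _ ≤ 1 * (8 * (k : ℝ)) := by gcongr
        _ ≤ 8 * y := by linarith
    · rw [smallWeight, if_neg (fun h' => h h'.2)]; simp
  calc _ ≤ ∑ k ∈ Icc 1 n, if k ^ 3 ≤ n then 8 * y else 0 := norm_sum_le_of_le _ h1
    _ = #{k ∈ Icc 1 n | k ^ 3 ≤ n} * (8 * y) := by rw [← sum_filter]; simp
    _ ≤ y * (8 * y) := by
        have hc : #{k ∈ Icc 1 n | k ^ 3 ≤ n} ≤ ⌊y⌋₊ := by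
          rw [← Nat.add_sub_cancel (n := ⌊y⌋₊) (m := 1), ← Nat.card_Icc]
          refine card_le_card fun k hk => ?_
          rw [mem_filter, mem_Icc] at hk
          exact mem_Icc.mpr ⟨hk.1.1, Nat.le_floor (hle k hk.2)⟩
        have : (#{k ∈ Icc 1 n | k ^ 3 ≤ n} : ℝ) ≤ y :=
          (Nat.cast_le.mpr hc).trans (Nat.floor_le hy0)
        gcongr
    _ = _ := by ring

theorem sum_dyadic {M : Type*} [AddCommMonoid M] (f : ℕ → M) (J : ℕ) :
    ∑ i ∈ range J, ∑ k ∈ Ico (2 ^ i) (2 * 2 ^ i), f k = ∑ k ∈ Ico 1 (2 ^ J), f k := by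
  induction J with
  | zero => simp
  | succ J ih =>
    rw [sum_range_succ, ih, pow_succ', sum_Ico_consecutive _ Nat.one_le_two_pow (by omega)]

/-- A dyadic block of the bilinear sum. If some divisor of the block crosses the threshold, then
`n ^ (1 / 3) / 2 ≤ K ≤ n ^ (2 / 3)`; otherwise the block is empty. -/
theorem norm_crossing_block_le {n K J : ℕ} (hn : 1 ≤ n) (hK : 1 ≤ K) (hJ : n < 2 ^ J) :
    ‖∑ k ∈ Ico K (2 * K), ∑ l ∈ Icc 1 n, crossingWeight n k *
        (if k.minFac ≤ leastPrimeThree n l then 1 else 0) * expKernel n k l‖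
      ≤ (J + 1) * (((n : ℝ) ^ (5 / 6 : ℝ)) * (34 + 32 * Real.log (16 * n))) := by
  have hn' : (1 : ℝ) ≤ n := by exact_mod_cast hn
  have hK' : (1 : ℝ) ≤ K := by exact_mod_cast hK
  have hlog : 0 ≤ Real.log (16 * n) := Real.log_nonneg (by linarith)
  by_cases hex : ∃ k ∈ Ico K (2 * K), IsSieveModulus n k ∧ IsCrossing n k
  swap
  · push Not at hex
    rw [sum_eq_zero]
    · simp only [norm_zero]; positivity
    · intro k hk
      rw [crossingWeight, if_neg (fun h => hex k hk h.1 h.2)]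
      simp
  obtain ⟨k₀, hk₀, hmod, hcr⟩ := hex
  rw [mem_Ico] at hk₀
  set y : ℝ := (n : ℝ) ^ (1 / 3 : ℝ) with hy
  have hy1 : 1 ≤ y := Real.one_le_rpow hn' (by norm_num)
  have hy3 : y ^ 3 = n := by
    rw [hy, ← Real.rpow_natCast, ← Real.rpow_mul (by positivity)]; norm_num
  have hKlow : y ≤ 2 * K := by
    have h1 : (n : ℝ) ≤ (2 * K : ℝ) ^ 3 := by
      have : n ≤ (2 * K) ^ 3 := hcr.1.le.trans (Nat.pow_le_pow_left hk₀.2.le 3)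
      exact_mod_cast this
    rw [← hy3] at h1
    exact (pow_le_pow_iff_left₀ (by positivity) (by positivity) (by norm_num)).mp h1
  have hKhigh : (K : ℝ) ≤ y ^ 2 := by
    have h1 : (K : ℝ) ^ 3 ≤ (n : ℝ) ^ 2 := by
      have : K ^ 3 ≤ n ^ 2 :=
        (Nat.pow_le_pow_left hk₀.1 3).trans (hcr.pow_three_le_sq hmod hn)
      exact_mod_cast this
    rw [← hy3, ← pow_mul, mul_comm 3 2, pow_mul] at h1
    exact (pow_le_pow_iff_left₀ (by positivity) (by positivity) (by norm_num)).mp h1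
  have hKn : (K : ℝ) ≤ n := hKhigh.trans (by rw [← hy3]; exact pow_le_pow_right₀ hy1 (by norm_num))
  set L : ℝ := 1 + Real.log (16 * K) with hL
  have hL1 : 1 ≤ L := by
    have := Real.log_nonneg (x := 16 * (K : ℝ)) (by linarith)
    linarith
  have hL2 : L ≤ 1 + Real.log (16 * n) := by
    rw [hL]; gcongr
  -- The terms with `l > n / K` or `k > n` vanish, as `k * l > n` there. Setting
  -- `P k = 0` for `k > n` keeps `P` below `2 ^ J`; `k = 0` is excluded because `minFac 0 = 2`.
  have hcut : ∀ k ∈ Ico K (2 * K), ∑ l ∈ Icc 1 n, crossingWeight n k *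
        (if k.minFac ≤ leastPrimeThree n l then 1 else 0) * expKernel n k l
      = ∑ l ∈ Icc 1 (n / K), crossingWeight n k * 1 *
        (if (if 1 ≤ k ∧ k ≤ n then k.minFac else 0) ≤ leastPrimeThree n l then expKernel n k l else 0) := by
    intro k hk
    rw [mem_Ico] at hk
    have hsub : Icc 1 (n / K) ⊆ Icc 1 n := Icc_subset_Icc_right (Nat.div_le_self n K)
    have hz : ∀ l ∈ Icc 1 n, l ∉ Icc 1 (n / K) → crossingWeight n k *
        (if k.minFac ≤ leastPrimeThree n l then 1 else 0) * expKernel n k l = 0 := by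
      intro l hl hl'
      rw [mem_Icc] at hl hl'
      have h1 : n / K < l := by omega
      have h2 : n < l * K := (Nat.div_lt_iff_lt_mul hK).mp h1
      have h3 : ¬ (k * l ≤ n ∧ (k * l) % 4 = 1) := by
        rintro ⟨h3, -⟩
        nlinarith [Nat.mul_le_mul_left l hk.1]
      rw [expKernel, if_neg h3, mul_zero]
    rw [← sum_subset hsub hz]
    refine sum_congr rfl fun l hl => ?_
    by_cases hkn : k ≤ n
    · have hP : (if 1 ≤ k ∧ k ≤ n then k.minFac else 0) = k.minFac :=
        if_pos ⟨hK.trans hk.1, hkn⟩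
      rw [hP]
      by_cases h : k.minFac ≤ leastPrimeThree n l <;> simp [h]
    · have h3 : ¬ (k * l ≤ n ∧ (k * l) % 4 = 1) := by
        rintro ⟨h3, -⟩
        nlinarith [(mem_Icc.mp hl).1]
      simp [expKernel, h3]
  rw [sum_congr rfl hcut]
  have htri := norm_triangular_bilinear_le (Ico K (2 * K)) (Icc 1 (n / K)) (expKernel n)
    (Real.sqrt_nonneg ((n / K : ℝ) + 32 * K * L)) (norm_dyadic_bilinear_le hK) J
    (fun k => if 1 ≤ k ∧ k ≤ n then k.minFac else 0) (leastPrimeThree n)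
    (fun k => by
      split_ifs with h
      · exact ((Nat.minFac_le h.1).trans h.2).trans_lt hJ
      · positivity)
    (fun l => (leastPrimeThree_le n l).trans_lt hJ) (crossingWeight n) (fun _ => 1)
  refine htri.trans ?_
  have hA : ∑ k ∈ Ico K (2 * K), ‖crossingWeight n k‖ ^ 2 ≤ K := by
    refine (sum_le_sum (g := fun _ => (1 : ℝ)) fun k _ =>
      pow_le_one₀ (norm_nonneg _) (norm_crossingWeight_le_one n k)).trans (le_of_eq ?_)
    simp; rw [two_mul, Nat.add_sub_cancel]
  have hB : ∑ l ∈ Icc 1 (n / K), ‖(1 : ℂ)‖ ^ 2 ≤ (n / K : ℝ) := by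
    simpa using (Nat.cast_div_le : ((n / K : ℕ) : ℝ) ≤ n / K)
  have hy52 : (n : ℝ) ^ (5 / 6 : ℝ) = √(y ^ 5) := by
    rw [hy, Real.sqrt_eq_rpow, ← Real.rpow_natCast, ← Real.rpow_mul (by positivity),
      ← Real.rpow_mul (by positivity)]
    norm_num
  refine mul_le_mul_of_nonneg_left ?_ (by positivity)
  calc _ ≤ √((n / K : ℝ) + 32 * K * L) * √(K : ℝ) * √(n / K : ℝ) := by gcongr
    _ = √(((n / K : ℝ) + 32 * K * L) * K * (n / K)) := by
        rw [Real.sqrt_mul (by positivity), Real.sqrt_mul (by positivity)]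
    _ ≤ √(y ^ 5 * (34 + 32 * Real.log (16 * n)) ^ 2) := by
        apply Real.sqrt_le_sqrt
        have e1 : ((n / K : ℝ) + 32 * K * L) * K * (n / K) = n ^ 2 / K + 32 * (n * K * L) := by
          field_simp
        have e2 : (n : ℝ) ^ 2 / K ≤ 2 * y ^ 5 := by
          rw [div_le_iff₀ (by positivity), ← hy3]
          have : (y ^ 3) ^ 2 = y ^ 5 * y := by ring
          rw [this]
          nlinarith [pow_pos (lt_of_lt_of_le one_pos hy1) 5]
        have e3 : (n : ℝ) * K * L ≤ y ^ 5 * (1 + Real.log (16 * n)) := by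
          calc (n : ℝ) * K * L ≤ n * y ^ 2 * (1 + Real.log (16 * n)) := by gcongr
            _ = _ := by rw [← hy3]; ring
        have hy5 : 0 ≤ y ^ 5 := by positivity
        rw [e1]
        have e4 : 34 + 32 * Real.log (16 * n) ≤ (34 + 32 * Real.log (16 * n)) ^ 2 := by nlinarith
        nlinarith [mul_le_mul_of_nonneg_left e4 hy5]
    _ = _ := by
        rw [Real.sqrt_mul (by positivity), Real.sqrt_sq (by positivity), hy52]

theorem norm_sum_crossingWeight_le {n J : ℕ} (hn : 1 ≤ n) (hJ : n < 2 ^ J) :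
    ‖∑ k ∈ Icc 1 n, ∑ l ∈ Icc 1 n, crossingWeight n k *
        (if k.minFac ≤ leastPrimeThree n l then 1 else 0) * expKernel n k l‖
      ≤ J * ((J + 1) * (((n : ℝ) ^ (5 / 6 : ℝ)) * (34 + 32 * Real.log (16 * n)))) := by
  have hsub : Icc 1 n ⊆ Ico 1 (2 ^ J) := fun k hk => by
    rw [mem_Icc] at hk
    exact mem_Ico.mpr ⟨hk.1, by omega⟩
  rw [sum_subset hsub, ← sum_dyadic]
  · refine (norm_sum_le_of_le _ fun i _ =>
      norm_crossing_block_le hn Nat.one_le_two_pow hJ).trans (le_of_eq ?_)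
    simp
  · intro k hk hk'
    rw [mem_Ico] at hk
    rw [mem_Icc] at hk'
    refine sum_eq_zero fun l hl => ?_
    have h3 : ¬ (k * l ≤ n ∧ (k * l) % 4 = 1) := by
      rintro ⟨h3, -⟩
      have : n < k := by omega
      nlinarith [(mem_Icc.mp hl).1]
    rw [expKernel, if_neg h3, mul_zero]

/-- With `t = log N ≥ 1 / 2`, all the logarithmic factors are bounded by multiples of `t`. -/
theorem norm_trigS_sqrt_two_le {N : ℝ} (hN : 2 ≤ N) :
    ‖trigS (Real.sqrt 2) N‖ ≤ 5536 * (N ^ (5 / 6 : ℝ) * Real.log N ^ 3) := by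
  rw [trigS_sqrt_two_eq]
  have hn2 : 2 ≤ ⌊N⌋₊ := Nat.le_floor (by exact_mod_cast hN)
  have hnN : (⌊N⌋₊ : ℝ) ≤ N := Nat.floor_le (by linarith)
  generalize ⌊N⌋₊ = n at *
  have hn2' : (2 : ℝ) ≤ n := by exact_mod_cast hn2
  have hsplit : ∑ k ∈ Icc 1 n, ∑ l ∈ Icc 1 n, (sieveWeight n k l : ℂ) * expKernel n k l
      = ∑ k ∈ Icc 1 n, ∑ l ∈ Icc 1 n, smallWeight n k * expKernel n k l
        + ∑ k ∈ Icc 1 n, ∑ l ∈ Icc 1 n, crossingWeight n k *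
          (if k.minFac ≤ leastPrimeThree n l then 1 else 0) * expKernel n k l := by
    simp_rw [← sum_add_distrib]
    refine sum_congr rfl fun k hk => sum_congr rfl fun l _ => ?_
    rw [mem_Icc] at hk
    rw [sieveWeight_eq hk.1 hk.2, add_mul]
  rw [hsplit]
  have h1 := norm_sum_smallWeight_le n
  have h2 := norm_sum_crossingWeight_le (n := n) (J := Nat.log 2 n + 1) (by omega)
    (Nat.lt_pow_succ_log_self (by norm_num) n)
  have hl2 : 1 / 2 ≤ Real.log 2 := by have := Real.log_two_gt_d9; linarith
  have hl2' : Real.log 2 ≤ 1 := by have := Real.log_two_lt_d9; linarith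
  set t : ℝ := Real.log N with ht
  have hln : Real.log n ≤ t := Real.log_le_log (by linarith) hnN
  have hlt : Real.log 2 ≤ t := Real.log_le_log (by norm_num) hN
  have ht2 : 1 / 2 ≤ t := hl2.trans hlt
  have hlog16 : Real.log (16 * n) ≤ 5 * t := by
    rw [Real.log_mul (by norm_num) (by linarith), show (16 : ℝ) = 2 ^ 4 by norm_num, Real.log_pow]
    push_cast; linarith
  have hlog0 : 0 ≤ Real.log (16 * n) := Real.log_nonneg (by linarith)
  have hJ : ((Nat.log 2 n + 1 : ℕ) : ℝ) ≤ 4 * t := by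
    have e1 : (2 : ℝ) ^ (Nat.log 2 n) ≤ n := by
      exact_mod_cast Nat.pow_log_le_self 2 (by omega)
    have e2 := Real.log_le_log (by positivity) e1
    rw [Real.log_pow] at e2
    have e3 : (0 : ℝ) ≤ Nat.log 2 n := by positivity
    push_cast
    nlinarith
  set A : ℝ := N ^ (5 / 6 : ℝ) with hA
  have hA0 : 0 ≤ A := by positivity
  have hnA : (n : ℝ) ^ (5 / 6 : ℝ) ≤ A := Real.rpow_le_rpow (by linarith) hnN (by norm_num)
  have hyA : ((n : ℝ) ^ (1 / 3 : ℝ)) ^ 2 ≤ A := by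
    refine le_trans ?_ hnA
    rw [← Real.rpow_natCast, ← Real.rpow_mul (by linarith)]
    exact Real.rpow_le_rpow_of_exponent_le (by linarith) (by norm_num)
  have ht3 : 1 ≤ 8 * t ^ 3 := by
    have : (1 / 2 : ℝ) ^ 3 ≤ t ^ 3 := pow_le_pow_left₀ (by norm_num) ht2 3
    linarith
  calc _ ≤ 8 * A + (4 * t) * ((4 * t + 2 * t) * (A * (68 * t + 32 * (5 * t)))) := by
        refine (norm_add_le _ _).trans (add_le_add (h1.trans (by linarith)) (h2.trans ?_))
        gcongr <;> linarith
    _ = 8 * A + 5472 * (A * t ^ 3) := by ring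
    _ ≤ 8 * (A * (8 * t ^ 3)) + 5472 * (A * t ^ 3) := by
        have : A * 1 ≤ A * (8 * t ^ 3) := by gcongr
        linarith
    _ = _ := by ring

end

theorem theorem7 :
    ∃ C : ℝ, ∀ N : ℝ, 2 ≤ N →
      ‖trigS (Real.sqrt 2) N‖ ≤ C * (N ^ (5 / 6 : ℝ) * Real.log N ^ (13 / 2 : ℝ)) := by
  -- The factor `16` absorbs `(log N) ^ (-7 / 2)`, since `log N ≥ log 2 ≥ 1 / 2`.
  refine ⟨5536 * 16, fun N hN => (norm_trigS_sqrt_two_le hN).trans ?_⟩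
  have hl2 : 1 / 2 ≤ Real.log 2 := by have := Real.log_two_gt_d9; linarith
  set t : ℝ := Real.log N with ht
  have ht2 : 1 / 2 ≤ t := hl2.trans (Real.log_le_log (by norm_num) hN)
  have ht0 : 0 < t := by linarith
  have e1 : t ^ (13 / 2 : ℝ) = t ^ 3 * t ^ (7 / 2 : ℝ) := by
    rw [← Real.rpow_natCast, ← Real.rpow_add ht0]; norm_num
  have e2 : 1 / 16 ≤ t ^ (7 / 2 : ℝ) :=
    calc (1 / 16 : ℝ) = (1 / 2 : ℝ) ^ (4 : ℝ) := by norm_num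
      _ ≤ (1 / 2 : ℝ) ^ (7 / 2 : ℝ) :=
        Real.rpow_le_rpow_of_exponent_ge (by norm_num) (by norm_num) (by norm_num)
      _ ≤ _ := Real.rpow_le_rpow (by norm_num) ht2 (by norm_num)
  have hA : 0 ≤ N ^ (5 / 6 : ℝ) * t ^ 3 := by
    have : 0 ≤ N ^ (5 / 6 : ℝ) := Real.rpow_nonneg (by linarith) _
    positivity
  rw [e1]
  nlinarith [mul_le_mul_of_nonneg_left e2 hA]
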